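/- Let $G$ be a finitely generated group. If $$1\to Z\xrightarrow{\ i\ } E\xrightarrow{\ \pi\ } G\to 1$$ is a central extension of $G$ by a finitely generated abelian group $Z$, its Euler class in $H^2(G,Z)$ is the class of the 2-cocycle $\omega_s(g_1,g_2)=s(g_1)s(g_2)s(g_1g_2)^{-1}\in Z$, where $s\colon G\to E$ is any set-theoretic section of $\pi$. A class in $H^2(G,Z)$ is bounded if it is represented by a 2-cocycle $G\times G\to Z$ with bounded (equivalently, finite) image. The extension is quasi-isometrically trivial if there is a quasi-isometry $f\colon E\to Z\times G$, with respect to word metrics of finite generating sets, such that $\pi_2\circ f$ and $\pi$ agree up to bounded error, where $\pi_2\colon Z\times G\to G$ is the projection. A group $G$ satisfies Property QITB if it is finitely generated and, for every finitely generated abelian group $Z$, the Euler class of every quasi-isometrically trivial central extension of $G$ by $Z$ is bounded. If the groups $G_1$ and $G_2$ satisfy Property QITB, then the free product $G_1 * G_2$ satisfies Property QITB. -/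

import Mathlib

universe u w

namespace QITB

/-! ### Word metrics and quasi-isometries -/

/-- `S` is a finite generating set of the group `G`. -/
def IsFiniteGeneratingSet {G : Type*} [Group G] (S : Set G) : Prop :=
  S.Finite ∧ Subgroup.closure S = ⊤

/-- The word metric of `S`: the path metric of the Cayley graph of `G` with respect to `S`
(in which `g` is joined with `g * s` for `s ∈ S`), restricted to the vertices. It is used only
for generating sets `S`, for which the Cayley graph is connected. -/
noncomputable def wordDist {G : Type*} [Group G] (S : Set G) (g h : G) : ℝ :=
  ((SimpleGraph.mulCayley S).dist g h : ℝ)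

/-- Quasi-isometric embeddings between sets with distance functions `dX` and `dY`. -/
def IsQIEmbedding {X Y : Type*} (dX : X → X → ℝ) (dY : Y → Y → ℝ) (f : X → Y) : Prop :=
  ∃ k c : ℝ, 1 ≤ k ∧ 0 ≤ c ∧ ∀ x₁ x₂ : X,
    dX x₁ x₂ / k - c ≤ dY (f x₁) (f x₂) ∧ dY (f x₁) (f x₂) ≤ k * dX x₁ x₂ + c

/-- `f` and `g` are uniformly close, i.e. they agree up to bounded error. -/
def UniformlyClose {X Y : Type*} (dY : Y → Y → ℝ) (f g : X → Y) : Prop :=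
  ∃ K : ℝ, ∀ x : X, dY (f x) (g x) ≤ K

/-- A quasi-isometry is a quasi-isometric embedding that admits a quasi-inverse. -/
def IsQuasiIsometry {X Y : Type*} (dX : X → X → ℝ) (dY : Y → Y → ℝ) (f : X → Y) : Prop :=
  IsQIEmbedding dX dY f ∧ ∃ g : Y → X, IsQIEmbedding dY dX g ∧
    UniformlyClose dX (g ∘ f) id ∧ UniformlyClose dY (f ∘ g) id

/-! ### Central extensions and their Euler classes -/

/-- The extension `1 → Z → E → G → 1` is central. -/
def IsCentral {Z E G : Type*} [Group Z] [Group E] [Group G] (X : GroupExtension Z E G) : Prop :=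
  X.inl.range ≤ Subgroup.center E

/-- The extension `1 → Z → E → G → 1` is quasi-isometrically trivial: there is a quasi-isometry
`f : E → Z × G` such that `π₂ ∘ f` and `π : E → G` agree up to bounded error. All groups carry
word metrics of finite generating sets; the choice of these sets does not matter. -/
def IsQuasiIsometricallyTrivial {Z E G : Type*} [Group Z] [Group E] [Group G]
    (X : GroupExtension Z E G) : Prop :=
  ∃ (SE : Set E) (SP : Set (Z × G)) (SG : Set G),
    IsFiniteGeneratingSet SE ∧ IsFiniteGeneratingSet SP ∧ IsFiniteGeneratingSet SG ∧
    ∃ f : E → Z × G, IsQuasiIsometry (wordDist SE) (wordDist SP) f ∧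
      UniformlyClose (wordDist SG) (fun e => (f e).2) (fun e => X.rightHom e)

/-- The abelian group `Z`, written additively, as a trivial `G`-module. The ring of scalars is a
copy of `ℤ` in the universe of `G`, as Mathlib's group cohomology asks for. -/
noncomputable abbrev coeff (G : Type u) [Group G] (Z : Type u) [CommGroup Z] :
    Rep (ULift.{u} ℤ) G :=
  Rep.trivial (ULift.{u} ℤ) G (Additive Z)

section EulerClass

variable {Z : Type u} {E : Type w} {G : Type u} [CommGroup Z] [Group E] [Group G]

/-- The cochain `ω_s(g₁, g₂) = s(g₁) s(g₂) s(g₁ g₂)⁻¹ ∈ Z` of a section `s : G → E`. -/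
noncomputable def sectionCochain (X : GroupExtension Z E G) (s : X.Section) (p : G × G) : Z :=
  (GroupExtension.Section.mul_mul_mul_inv_mem_range_inl s p.1 p.2).choose

theorem inl_sectionCochain (X : GroupExtension Z E G) (s : X.Section) (g h : G) :
    X.inl (sectionCochain X s (g, h)) = s g * s h * (s (g * h))⁻¹ :=
  (GroupExtension.Section.mul_mul_mul_inv_mem_range_inl s g h).choose_spec

theorem inl_sectionCochain_mul (X : GroupExtension Z E G) (s : X.Section) (g h : G) :
    X.inl (sectionCochain X s (g, h)) * s (g * h) = s g * s h := by
  rw [inl_sectionCochain]; group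

theorem inl_comm (X : GroupExtension Z E G) (hX : IsCentral X) (z : Z) (e : E) :
    e * X.inl z = X.inl z * e :=
  Subgroup.mem_center_iff.mp (hX ⟨z, rfl⟩) e

/-- `ω_s` is a 2-cocycle. -/
theorem sectionCochain_mem_cocycles₂ (X : GroupExtension Z E G) (hX : IsCentral X)
    (s : X.Section) :
    (fun p => Additive.ofMul (sectionCochain X s p)) ∈
      groupCohomology.cocycles₂ (coeff G Z) := by
  refine (groupCohomology.mem_cocycles₂_iff (A := coeff G Z) _).2 fun g h j => ?_
  change Additive.ofMul (sectionCochain X s (g * h, j) * sectionCochain X s (g, h)) =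
    Additive.ofMul (sectionCochain X s (h, j) * sectionCochain X s (g, h * j))
  congr 1
  apply X.inl_injective
  apply mul_right_cancel (b := s (g * h * j))
  calc X.inl (sectionCochain X s (g * h, j) * sectionCochain X s (g, h)) * s (g * h * j)
      = X.inl (sectionCochain X s (g, h)) *
          (X.inl (sectionCochain X s (g * h, j)) * s (g * h * j)) := by
        rw [mul_comm (sectionCochain X s (g * h, j)), map_mul, mul_assoc]
    _ = s g * s h * s j := by
        rw [inl_sectionCochain_mul, ← mul_assoc, inl_sectionCochain_mul]
    _ = s g * (X.inl (sectionCochain X s (h, j)) * s (h * j)) := by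
        rw [inl_sectionCochain_mul, mul_assoc]
    _ = X.inl (sectionCochain X s (h, j)) * (s g * s (h * j)) := by
        rw [← mul_assoc, inl_comm X hX, mul_assoc]
    _ = X.inl (sectionCochain X s (h, j) * sectionCochain X s (g, h * j)) *
          s (g * h * j) := by
        rw [← inl_sectionCochain_mul X s g (h * j), map_mul X.inl, mul_assoc, mul_assoc g h j]

/-- The class in `H²(G, Z)` of the cocycle of a section. -/
noncomputable def sectionClass (X : GroupExtension Z E G) (hX : IsCentral X) (s : X.Section) :
    groupCohomology.H2 (coeff G Z) :=
  groupCohomology.H2π (coeff G Z) ⟨_, sectionCochain_mem_cocycles₂ X hX s⟩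

/-- The class of the cocycle of a section does not depend on the section. -/
theorem sectionClass_eq (X : GroupExtension Z E G) (hX : IsCentral X) (s t : X.Section) :
    sectionClass X hX s = sectionClass X hX t := by
  refine (groupCohomology.H2π_eq_iff (A := coeff G Z) _ _).2 ?_
  choose n hn using fun g => GroupExtension.Section.exists_eq_inl_mul s t g
  refine ⟨fun g => Additive.ofMul (n g), funext fun p => ?_⟩
  obtain ⟨g, h⟩ := p
  change Additive.ofMul (n h / n (g * h) * n g) =
    Additive.ofMul (sectionCochain X s (g, h) / sectionCochain X t (g, h))
  congr 1
  rw [div_mul_eq_mul_div, div_eq_div_iff_mul_eq_mul]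
  apply X.inl_injective
  apply mul_right_cancel (b := t (g * h))
  calc X.inl (n h * n g * sectionCochain X t (g, h)) * t (g * h)
      = X.inl (n g) * X.inl (n h) * (t g * t h) := by
        rw [← inl_sectionCochain_mul, mul_comm (n h), map_mul, map_mul, mul_assoc]
    _ = s g * s h := by
        rw [hn g, hn h, mul_assoc, mul_assoc, ← mul_assoc (t g), inl_comm X hX]
        simp only [mul_assoc]
    _ = X.inl (sectionCochain X s (g, h) * n (g * h)) * t (g * h) := by
        rw [← inl_sectionCochain_mul X s, hn (g * h), map_mul X.inl, mul_assoc]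

/-- The Euler class of a central extension. -/
noncomputable def eulerClass (X : GroupExtension Z E G) (hX : IsCentral X) :
    groupCohomology.H2 (coeff G Z) :=
  sectionClass X hX X.surjInvRightHom

/-- A class in `H²(G, Z)` is bounded if it is represented by a bounded cocycle, i.e. if it lies in
the image of the comparison map. A subset of a finitely generated abelian group is bounded
if and only if it is finite. -/
def IsBoundedClass (α : groupCohomology.H2 (coeff G Z)) : Prop :=
  ∃ ω : groupCohomology.cocycles₂ (coeff G Z),
    (Set.range fun p : G × G => ω p).Finite ∧ groupCohomology.H2π (coeff G Z) ω = α

end EulerClass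

/-- The finitely generated group `G` satisfies Property QITB: for every finitely generated abelian
group `Z`, the Euler class of any quasi-isometrically trivial central extension of `G` by `Z` is
bounded. (All the groups involved are countable, so the choice of universes for `Z` and `E` does not
matter.) -/
def PropertyQITB (G : Type u) [Group G] : Prop :=
  Group.FG G ∧ ∀ (Z : Type u) (E : Type w) [CommGroup Z] [Group E] (_ : Group.FG Z)
    (X : GroupExtension Z E G) (hX : IsCentral X),
    IsQuasiIsometricallyTrivial X → IsBoundedClass (eulerClass X hX)

end QITB

namespace QITB

open scoped Pointwise

/-! ### Word metrics -/

section WordMetric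

variable {G H : Type*} [Group G] [Group H] {S : Set G}

/-! Quasi-isometric triviality is turned into algebra: for a central extension of finitely generated
groups with finitely generated kernel, it amounts to having a section `s` for which `s a⁻¹ * s (a *
x)` takes finitely many values for each `x` (`exists_section`,
`isQuasiIsometricallyTrivial_of_section`). Such a section restricts to the preimage of each free
factor, so the hypotheses yield sections `s₁`, `s₂` over the factors with finite cochains `c₁`,
`c₂`.

To glue them (`isBoundedClass_coprod`), pull `c₁` and `c₂` back along the retractions onto the
factors and multiply, getting a cocycle `ω` with finite image. Twisting `E` by `ω⁻¹` makes `s₁` and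
`s₂` homomorphisms, and the universal property of the free product extends them to a homomorphic
section. Read back in `E`, this is a section with cochain exactly `ω`. -/

theorem IsFiniteGeneratingSet.reachable_mul (hS : IsFiniteGeneratingSet S) (x : G) :
    ∀ a : G, (SimpleGraph.mulCayley S).Reachable a (a * x) := by
  have hx : x ∈ Subgroup.closure S := hS.2 ▸ Subgroup.mem_top x
  induction hx using Subgroup.closure_induction with
  | mem s hs =>
    intro a
    by_cases h : a = a * s
    · rw [← h]
    · exact SimpleGraph.Adj.reachable
        ((SimpleGraph.mulCayley_adj S _ _).2 ⟨h, Or.inl (by simpa using hs)⟩)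
  | one => intro a; simp
  | mul x y _ _ hx hy => intro a; rw [← mul_assoc]; exact (hx a).trans (hy _)
  | inv x _ hx => intro a; simpa using (hx (a * x⁻¹)).symm

theorem IsFiniteGeneratingSet.connected (hS : IsFiniteGeneratingSet S) :
    (SimpleGraph.mulCayley S).Connected :=
  ⟨fun a b => by simpa using hS.reachable_mul (a⁻¹ * b) a⟩

theorem wordDist_nonneg (S : Set G) (a b : G) : 0 ≤ wordDist S a b := Nat.cast_nonneg _

theorem exists_finite_of_walk (hS : S.Finite) (n : ℕ) :
    ∃ F : Set G, F.Finite ∧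
      ∀ (a b : G) (p : (SimpleGraph.mulCayley S).Walk a b), p.length = n → a⁻¹ * b ∈ F := by
  induction n with
  | zero =>
    refine ⟨{1}, Set.finite_singleton 1, fun a b p hp => ?_⟩
    simp [SimpleGraph.Walk.eq_of_length_eq_zero hp]
  | succ n ih =>
    obtain ⟨F, hF, h⟩ := ih
    refine ⟨(S ∪ S⁻¹) * F, (hS.union hS.inv).mul hF, fun a b p hp => ?_⟩
    cases p with
    | nil => simp at hp
    | @cons _ c _ hac p =>
      refine ⟨a⁻¹ * c, ?_, c⁻¹ * b, h c b p (by simpa using hp), by simp [mul_assoc]⟩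
      rcases ((SimpleGraph.mulCayley_adj S _ _).1 hac).2 with h | h
      · exact Or.inl h
      · exact Or.inr (by simpa using h)

/-- Balls in word metrics are finite. -/
theorem IsFiniteGeneratingSet.exists_finite (hS : IsFiniteGeneratingSet S) (C : ℝ) :
    ∃ F : Set G, F.Finite ∧ ∀ a b : G, wordDist S a b ≤ C → a⁻¹ * b ∈ F := by
  choose F hF h using exists_finite_of_walk hS.1
  refine ⟨⋃ n ∈ Set.Iic ⌊C⌋₊, F n, (Set.finite_Iic _).biUnion fun n _ => hF n, fun a b hab => ?_⟩
  obtain ⟨p, hp⟩ := hS.connected.exists_walk_length_eq_dist a b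
  exact Set.mem_biUnion (Set.mem_Iic.2 (Nat.le_floor (by rw [hp]; exact hab))) (h _ a b p rfl)

/-- Edges are given by right multiplication, so left translations are graph homomorphisms. -/
theorem wordDist_mul_left_le (hS : IsFiniteGeneratingSet S) (c a b : G) :
    wordDist S (c * a) (c * b) ≤ wordDist S a b := by
  obtain ⟨p, hp⟩ := hS.connected.exists_walk_length_eq_dist a b
  have := SimpleGraph.dist_le (p.map (⟨fun x => c * x,
    fun h => SimpleGraph.mulCayley_adj_mul_iff_right.2 h⟩ :
      SimpleGraph.mulCayley S →g SimpleGraph.mulCayley S))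
  rw [SimpleGraph.Walk.length_map, hp] at this
  exact Nat.cast_le.2 this

/-- Converse to `exists_finite`; together they trade bounded distance for finiteness of the set of
increments. -/
theorem IsFiniteGeneratingSet.exists_bound (hS : IsFiniteGeneratingSet S) {F : Set G}
    (hF : F.Finite) : ∃ C : ℝ, ∀ a b : G, a⁻¹ * b ∈ F → wordDist S a b ≤ C := by
  obtain ⟨C, hC⟩ := (hF.image (wordDist S 1)).bddAbove
  refine ⟨C, fun a b hab => ?_⟩
  calc wordDist S a b = wordDist S (a * 1) (a * (a⁻¹ * b)) := by simp
    _ ≤ wordDist S 1 (a⁻¹ * b) := wordDist_mul_left_le hS _ _ _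
    _ ≤ C := hC ⟨_, hab, rfl⟩

/-- A map between groups has finite increments if for each `x` the element `f a⁻¹ * f (a * x)`
takes only finitely many values. For finitely generated groups these are the Lipschitz maps. -/
def HasFiniteIncrements (f : G → H) : Prop :=
  ∀ x : G, (Set.range fun a => (f a)⁻¹ * f (a * x)).Finite

theorem HasFiniteIncrements.exists_lipschitz {f : G → H} (hf : HasFiniteIncrements f)
    {T : Set H} (hS : IsFiniteGeneratingSet S) (hT : IsFiniteGeneratingSet T) :
    ∃ k : ℝ, 1 ≤ k ∧ ∀ a b : G, wordDist T (f a) (f b) ≤ k * wordDist S a b := by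
  have hF : (⋃ x ∈ S ∪ S⁻¹, Set.range fun a => (f a)⁻¹ * f (a * x)).Finite :=
    (hS.1.union hS.1.inv).biUnion fun x _ => hf x
  obtain ⟨C, hC⟩ := hT.exists_bound hF
  refine ⟨max C 1, le_max_right _ _, fun a b => ?_⟩
  have key : ∀ (a b : G) (p : (SimpleGraph.mulCayley S).Walk a b),
      wordDist T (f a) (f b) ≤ max C 1 * p.length := by
    intro a b p
    induction p with
    | nil => simp [wordDist]
    | @cons a c b hac p ih =>
      have h1 : wordDist T (f a) (f c) ≤ C := by
        refine hC _ _ (Set.mem_biUnion (x := a⁻¹ * c) ?_ ⟨a, by simp⟩)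
        rcases ((SimpleGraph.mulCayley_adj S _ _).1 hac).2 with h | h
        · exact Or.inl h
        · exact Or.inr (by simpa using h)
      have h2 : wordDist T (f a) (f b) ≤ wordDist T (f a) (f c) + wordDist T (f c) (f b) := by
        unfold wordDist
        exact_mod_cast hT.connected.dist_triangle
      rw [SimpleGraph.Walk.length_cons]
      push_cast
      linarith [le_max_left C 1]
  obtain ⟨p, hp⟩ := hS.connected.exists_walk_length_eq_dist a b
  simpa [wordDist, hp] using key a b p

/-- A bijection that has finite increments in both directions is a quasi-isometry. -/
theorem isQuasiIsometry_of_hasFiniteIncrements (f : G ≃ H) (hf : HasFiniteIncrements f)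
    (hf' : HasFiniteIncrements f.symm) {T : Set H} (hS : IsFiniteGeneratingSet S)
    (hT : IsFiniteGeneratingSet T) : IsQuasiIsometry (wordDist S) (wordDist T) f := by
  obtain ⟨k, hk, h⟩ := hf.exists_lipschitz hS hT
  obtain ⟨k', hk', h'⟩ := hf'.exists_lipschitz hT hS
  have hm : 0 < max k k' := lt_max_of_lt_left (by linarith)
  refine ⟨⟨max k k', 0, le_max_of_le_left hk, le_rfl, fun a b => ⟨?_, ?_⟩⟩, f.symm,
    ⟨max k k', 0, le_max_of_le_left hk, le_rfl, fun a b => ⟨?_, ?_⟩⟩,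
    ⟨0, fun a => by simp [wordDist]⟩, ⟨0, fun a => by simp [wordDist]⟩⟩
  · rw [sub_zero, div_le_iff₀ hm, mul_comm]
    calc wordDist S a b = wordDist S (f.symm (f a)) (f.symm (f b)) := by simp
      _ ≤ k' * wordDist T (f a) (f b) := h' _ _
      _ ≤ _ := mul_le_mul_of_nonneg_right (le_max_right _ _) (wordDist_nonneg _ _ _)
  · rw [add_zero]
    exact (h a b).trans (mul_le_mul_of_nonneg_right (le_max_left _ _) (wordDist_nonneg _ _ _))
  · rw [sub_zero, div_le_iff₀ hm, mul_comm]
    calc wordDist T a b = wordDist T (f (f.symm a)) (f (f.symm b)) := by simp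
      _ ≤ k * wordDist S (f.symm a) (f.symm b) := h _ _
      _ ≤ _ := mul_le_mul_of_nonneg_right (le_max_left _ _) (wordDist_nonneg _ _ _)
  · rw [add_zero]
    exact (h' a b).trans (mul_le_mul_of_nonneg_right (le_max_right _ _) (wordDist_nonneg _ _ _))

theorem exists_isFiniteGeneratingSet (G : Type*) [Group G] [Group.FG G] :
    ∃ S : Set G, IsFiniteGeneratingSet S :=
  let ⟨S, h, h'⟩ := Group.fg_iff.1 ‹Group.FG G›
  ⟨S, h', h⟩

end WordMetric

/-! ### Quasi-isometrically trivial extensions and sections with finite increments -/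

section Sections

variable {Z : Type u} {E : Type w} {G : Type u} [Group E] [Group G]

/-- A quasi-isometrically trivial extension has a section with finite increments. -/
theorem IsQuasiIsometricallyTrivial.exists_section [Group Z] {X : GroupExtension Z E G}
    (hX : IsQuasiIsometricallyTrivial X) : ∃ s : X.Section, HasFiniteIncrements s := by
  obtain ⟨SE, SP, SG, hSE, hSP, hSG, f,
    ⟨-, t, ⟨k, c, hk, -, ht⟩, -, ⟨K', hK'⟩⟩, ⟨K, hK⟩⟩ := hX
  obtain ⟨F, hF, hFK⟩ := hSG.exists_finite K
  obtain ⟨F', hF', hFK'⟩ := hSP.exists_finite K'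
  -- The quasi-inverse restricted to `1 × G` is a section only up to the error `d`. Balls are
  -- finite, so `d` has finite range, and multiplying by lifts of its values gives a true section
  -- without spoiling finite increments.
  let d : G → G := fun g => (X.rightHom (t (1, g)))⁻¹ * g
  have hd : (Set.range d).Finite := by
    refine (hF.inv.mul (hF'.image Prod.snd)).subset ?_
    rintro _ ⟨g, rfl⟩
    have h1 := hFK _ _ (hK (t (1, g)))
    have h2 := hFK' _ _ (hK' (1, g))
    exact ⟨_, Set.inv_mem_inv.2 h1, _, ⟨_, h2, rfl⟩, by simp [d]⟩
  let l := Function.surjInv X.rightHom_surjective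
  have hl : ∀ g, X.rightHom (l g) = g := Function.surjInv_eq X.rightHom_surjective
  refine ⟨⟨fun g => t (1, g) * l (d g), fun g => by simp [hl, d]⟩, fun x => ?_⟩
  obtain ⟨C, hC⟩ := hSP.exists_bound (Set.finite_singleton ((1, x) : Z × G))
  obtain ⟨F₁, hF₁, h₁⟩ := hSE.exists_finite (k * C + c)
  have hlF := hd.image l
  refine ((hlF.inv.mul hF₁).mul hlF).subset ?_
  rintro _ ⟨a, rfl⟩
  have h2 : (t (1, a))⁻¹ * t (1, a * x) ∈ F₁ := by
    refine h₁ _ _ ((ht _ _).2.trans ?_)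
    have := hC (1, a) (1, a * x) (by simp)
    have := mul_le_mul_of_nonneg_left this (by linarith : 0 ≤ k)
    linarith
  refine ⟨_, ⟨_, Set.inv_mem_inv.2 ⟨_, ⟨a, rfl⟩, rfl⟩, _, h2, rfl⟩, _, ⟨_, ⟨a * x, rfl⟩, rfl⟩, ?_⟩
  simp [mul_assoc]

theorem exists_inl_mul_section [Group Z] {X : GroupExtension Z E G} (s : X.Section) (e : E) :
    ∃ z : Z, X.inl z * s (X.rightHom e) = e := by
  have : e * (s (X.rightHom e))⁻¹ ∈ X.inl.range := by
    rw [X.range_inl_eq_ker_rightHom, MonoidHom.mem_ker]; simp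
  obtain ⟨z, hz⟩ := this
  exact ⟨z, by simp [hz]⟩

/-- The bijection between the product and the extension that comes from a section. -/
noncomputable def sectionEquiv [Group Z] {X : GroupExtension Z E G} (s : X.Section) :
    E ≃ Z × G where
  toFun e := ((exists_inl_mul_section s e).choose, X.rightHom e)
  invFun p := X.inl p.1 * s p.2
  left_inv e := (exists_inl_mul_section s e).choose_spec
  right_inv p := by
    have h := (exists_inl_mul_section s (X.inl p.1 * s p.2)).choose_spec
    have hp : X.rightHom (X.inl p.1 * s p.2) = p.2 := by simp
    refine Prod.ext (X.inl_injective (mul_right_cancel (b := s p.2) ?_)) hp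
    simpa only [hp] using h

theorem inl_sectionEquiv_mul [Group Z] {X : GroupExtension Z E G} (s : X.Section) (e : E) :
    X.inl (sectionEquiv s e).1 * s (X.rightHom e) = e :=
  (exists_inl_mul_section s e).choose_spec

theorem group_fg_of_extension [Group Z] [Group.FG Z] [Group.FG G] (X : GroupExtension Z E G) :
    Group.FG E := by
  obtain ⟨T, hT⟩ := exists_isFiniteGeneratingSet G
  let l := Function.surjInv X.rightHom_surjective
  have hl : ∀ g, X.rightHom (l g) = g := Function.surjInv_eq X.rightHom_surjective
  have h1 : X.inl.range.FG := (Group.fg_iff_subgroup_fg _).1 inferInstance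
  have h2 : (Subgroup.closure (l '' T)).FG := (Subgroup.fg_iff _).2 ⟨_, rfl, hT.1.image l⟩
  have h3 : X.inl.range ⊔ Subgroup.closure (l '' T) = ⊤ := by
    have hk : X.rightHom.ker ≤ X.inl.range ⊔ Subgroup.closure (l '' T) :=
      X.range_inl_eq_ker_rightHom ▸ le_sup_left
    rw [← Subgroup.comap_map_eq_self hk, eq_top_iff, ← Subgroup.map_le_iff_le_comap]
    refine le_trans le_top ?_
    rw [← hT.2, Subgroup.closure_le]
    intro g hg
    exact ⟨l g, Subgroup.mem_sup_right (Subgroup.subset_closure ⟨g, hg, rfl⟩), hl g⟩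
  exact Group.fg_def.2 (h3 ▸ h1.sup h2)

/-- A central extension that has a section with finite increments is quasi-isometrically
trivial. -/
theorem isQuasiIsometricallyTrivial_of_section [CommGroup Z] [Group.FG Z] [Group.FG G]
    (X : GroupExtension Z E G) (hX : IsCentral X) (s : X.Section) (hs : HasFiniteIncrements s) :
    IsQuasiIsometricallyTrivial X := by
  have := group_fg_of_extension X
  obtain ⟨SE, hSE⟩ := exists_isFiniteGeneratingSet E
  obtain ⟨SP, hSP⟩ := exists_isFiniteGeneratingSet (Z × G)
  obtain ⟨SG, hSG⟩ := exists_isFiniteGeneratingSet G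
  refine ⟨SE, SP, SG, hSE, hSP, hSG, sectionEquiv s,
    isQuasiIsometry_of_hasFiniteIncrements _ (fun x => ?_) (fun p => ?_) hSE hSP,
    0, fun e => by simp [sectionEquiv, wordDist]⟩
  -- With `a = s (π e)` and `b = s (π (e * x))`, the `Z`-coordinate changes by `a * x * b⁻¹`. This
  -- is central, so conjugation by `a` turns it into `x * (a⁻¹ * b)⁻¹`, which depends only on `x`
  -- and an increment of `s`.
  · have hfin := ((hs (X.rightHom x)).image fun y => x * y⁻¹).preimage X.inl_injective.injOn
    refine (hfin.prod (Set.finite_singleton (X.rightHom x))).subset ?_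
    rintro _ ⟨e, rfl⟩
    refine ⟨⟨_, ⟨X.rightHom e, rfl⟩, ?_⟩, ?_⟩
    · have h1 := eq_mul_inv_of_mul_eq (inl_sectionEquiv_mul s e)
      have h2 := inl_sectionEquiv_mul s (e * x)
      rw [map_mul X.rightHom] at h2
      have h3 := eq_mul_inv_of_mul_eq h2
      set a := s (X.rightHom e)
      set b := s (X.rightHom e * X.rightHom x)
      change x * (a⁻¹ * b)⁻¹ = X.inl ((sectionEquiv s e).1⁻¹ * (sectionEquiv s (e * x)).1)
      have h4 := inl_comm X hX ((sectionEquiv s e).1⁻¹ * (sectionEquiv s (e * x)).1) a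
      have h5 : X.inl ((sectionEquiv s e).1⁻¹ * (sectionEquiv s (e * x)).1) = a * x * b⁻¹ := by
        rw [map_mul, map_inv, h1, h3]; group
      rw [h5] at h4 ⊢
      have h6 : a * x * b⁻¹ = a⁻¹ * (a * x * b⁻¹ * a) := by rw [← h4]; group
      rw [h6]; group
    · simp [sectionEquiv]
  · refine ((hs p.2).image fun y => X.inl p.1 * y).subset ?_
    rintro _ ⟨q, rfl⟩
    refine ⟨_, ⟨q.2, rfl⟩, ?_⟩
    have := inl_comm X hX p.1 (s q.2)⁻¹
    change X.inl p.1 * ((s q.2)⁻¹ * s (q.2 * p.2)) =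
      (X.inl q.1 * s q.2)⁻¹ * (X.inl (q.1 * p.1) * s (q.2 * p.2))
    rw [← mul_assoc, ← this, map_mul X.inl]
    group

/-! ### Restriction to a retract -/

variable [CommGroup Z] {H : Type u} [Group H]

/-- The restriction of an extension of `G` to a retract `H` of `G`. -/
def restrict (X : GroupExtension Z E G) (ι : H →* G) (r : G →* H) (hr : ∀ h, r (ι h) = h) :
    GroupExtension Z ((ι.comp (r.comp X.rightHom)).eqLocus X.rightHom) H where
  inl := X.inl.codRestrict _ fun z => by
    change ι (r (X.rightHom (X.inl z))) = X.rightHom (X.inl z); simp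
  rightHom := (r.comp X.rightHom).comp (Subgroup.subtype _)
  inl_injective a b h := X.inl_injective (congrArg Subtype.val h)
  range_inl_eq_ker_rightHom := by
    ext ⟨e, he⟩
    have he' : ι (r (X.rightHom e)) = X.rightHom e := he
    rw [MonoidHom.mem_range, MonoidHom.mem_ker]
    constructor
    · rintro ⟨z, hz⟩
      have : X.inl z = e := congrArg Subtype.val hz
      subst this
      change r (X.rightHom (X.inl z)) = 1
      simp
    · intro h
      have h' : r (X.rightHom e) = 1 := h
      have hk : e ∈ X.inl.range := by
        rw [X.range_inl_eq_ker_rightHom, MonoidHom.mem_ker, ← he', h', map_one]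
      obtain ⟨z, hz⟩ := hk
      exact ⟨z, Subtype.ext hz⟩
  rightHom_surjective h := by
    obtain ⟨e, he⟩ := X.rightHom_surjective (ι h)
    refine ⟨⟨e, ?_⟩, ?_⟩
    · change ι (r (X.rightHom e)) = X.rightHom e
      rw [he, hr]
    · change r (X.rightHom e) = h
      rw [he, hr]

theorem isCentral_restrict {X : GroupExtension Z E G} (hX : IsCentral X) (ι : H →* G) (r : G →* H)
    (hr : ∀ h, r (ι h) = h) : IsCentral (restrict X ι r hr) := by
  rintro _ ⟨z, rfl⟩
  exact Subgroup.mem_center_iff.2 fun e => Subtype.ext (inl_comm X hX z e)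

theorem rightHom_restrict_section {X : GroupExtension Z E G} {ι : H →* G} {r : G →* H}
    {hr : ∀ h, r (ι h) = h} (s : (restrict X ι r hr).Section) (h : H) :
    X.rightHom (s h).1 = ι h := by
  have h1 : ι (r (X.rightHom (s h).1)) = X.rightHom (s h).1 := (s h).2
  have h2 : r (X.rightHom (s h).1) = h := s.rightInverse_rightHom h
  rw [← h1, h2]

/-- If `s` has finite increments, so does `s ∘ ι`: its increments at `x` are among those of `s` at
`ι x`. -/
theorem IsQuasiIsometricallyTrivial.restrict [Group.FG Z] [Group.FG H] {X : GroupExtension Z E G}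
    (hX : IsCentral X) (hq : IsQuasiIsometricallyTrivial X) (ι : H →* G) (r : G →* H)
    (hr : ∀ h, r (ι h) = h) : IsQuasiIsometricallyTrivial (restrict X ι r hr) := by
  obtain ⟨s, hs⟩ := hq.exists_section
  refine isQuasiIsometricallyTrivial_of_section _ (isCentral_restrict hX ι r hr)
    ⟨fun h => ⟨s (ι h), ?_⟩, fun h => ?_⟩ fun x => ?_
  · change ι (r (X.rightHom (s (ι h)))) = X.rightHom (s (ι h))
    simp [hr]
  · change r (X.rightHom (s (ι h))) = h
    simp [hr]
  · refine Set.Finite.of_finite_image ((hs (ι x)).subset ?_) Subtype.val_injective.injOn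
    rintro _ ⟨_, ⟨a, rfl⟩, rfl⟩
    exact ⟨ι a, by simp⟩

end Sections

/-! ### Bounded Euler classes -/

section BoundedClass

variable {Z : Type u} {E : Type w} {G : Type u} [CommGroup Z] [Group E] [Group G]
  {X : GroupExtension Z E G}

theorem sectionCochain_eq {s : X.Section} {g h : G} {z : Z}
    (hz : X.inl z * s (g * h) = s g * s h) : sectionCochain X s (g, h) = z :=
  X.inl_injective (mul_right_cancel ((inl_sectionCochain_mul X s g h).trans hz.symm))

theorem sectionCochain_cocycle (hX : IsCentral X) (s : X.Section) (g h j : G) :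
    sectionCochain X s (g * h, j) * sectionCochain X s (g, h) =
      sectionCochain X s (h, j) * sectionCochain X s (g, h * j) :=
  (groupCohomology.mem_cocycles₂_iff (A := coeff G Z) _).1
    (sectionCochain_mem_cocycles₂ X hX s) g h j

/-- The translate of a section by a function `n : G → Z`. -/
def translate (s : X.Section) (n : G → Z) : X.Section :=
  ⟨fun g => X.inl (n g) * s g, fun g => by simp⟩

theorem sectionCochain_translate (hX : IsCentral X) (s : X.Section) (n : G → Z) (g h : G) :
    sectionCochain X (translate s n) (g, h) =
      n h / n (g * h) * n g * sectionCochain X s (g, h) := by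
  apply sectionCochain_eq
  change X.inl (n h / n (g * h) * n g * sectionCochain X s (g, h)) *
    (X.inl (n (g * h)) * s (g * h)) = X.inl (n g) * s g * (X.inl (n h) * s h)
  have e : n h / n (g * h) * n g * sectionCochain X s (g, h) * n (g * h) =
      n g * n h * sectionCochain X s (g, h) := by
    rw [div_eq_mul_inv]
    calc _ = n g * n h * sectionCochain X s (g, h) * ((n (g * h))⁻¹ * n (g * h)) := by ac_rfl
      _ = _ := by simp
  calc _ = X.inl (n g) * (X.inl (n h) * s g) * s h := by
        rw [← mul_assoc, ← map_mul, e, map_mul, mul_assoc, inl_sectionCochain_mul]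
        simp [mul_assoc]
    _ = _ := by rw [← inl_comm X hX (n h)]; simp [mul_assoc]

/-- The Euler class is bounded if and only if some section has a finite cochain. -/
theorem isBoundedClass_eulerClass_iff (hX : IsCentral X) :
    IsBoundedClass (eulerClass X hX) ↔
      ∃ s : X.Section, (Set.range (sectionCochain X s)).Finite := by
  constructor
  · rintro ⟨ω, hω, h⟩
    -- The bounded representative differs from the cochain of the chosen section by the coboundary
    -- of `n`; translating the section by `n` absorbs it.
    obtain ⟨n, hn⟩ := (groupCohomology.H2π_eq_iff (A := coeff G Z) _ _).1 h
    let m : G → Z := fun g => Additive.toMul (α := Z) (n g)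
    refine ⟨translate X.surjInvRightHom m,
      (hω.image fun a : Additive Z => a.toMul).subset ?_⟩
    rintro _ ⟨⟨g, h⟩, rfl⟩
    refine ⟨_, ⟨(g, h), rfl⟩, ?_⟩
    have h1 : m h / m (g * h) * m g =
        Additive.toMul (α := Z) (ω (g, h)) / sectionCochain X X.surjInvRightHom (g, h) :=
      congrFun hn (g, h)
    exact (div_eq_iff_eq_mul.1 h1.symm).trans
      (sectionCochain_translate hX X.surjInvRightHom _ g h).symm
  · rintro ⟨s, hs⟩
    refine ⟨⟨_, sectionCochain_mem_cocycles₂ X hX s⟩, ?_, sectionClass_eq X hX _ _⟩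
    refine (hs.image Additive.ofMul).subset ?_
    rintro _ ⟨p, rfl⟩
    exact ⟨_, ⟨p, rfl⟩, rfl⟩

theorem exists_section_map_one (hX : IsCentral X) (h : IsBoundedClass (eulerClass X hX)) :
    ∃ s : X.Section, s 1 = 1 ∧ (Set.range (sectionCochain X s)).Finite := by
  obtain ⟨s, hs⟩ := (isBoundedClass_eulerClass_iff hX).1 h
  obtain ⟨z, hz⟩ := exists_inl_mul_section s 1
  rw [map_one] at hz
  -- The coboundary of a constant `z` is the constant `z`, so finiteness survives.
  refine ⟨translate s fun _ => z, hz, (hs.image fun y => z * y).subset ?_⟩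
  rintro _ ⟨⟨g, h⟩, rfl⟩
  exact ⟨_, ⟨(g, h), rfl⟩, by simp [sectionCochain_translate hX]⟩

end BoundedClass

/-! ### Gluing sections over the factors of a free product -/

section Twist

variable {Z : Type u} {E : Type w} {G : Type u} [CommGroup Z] [Group E] [Group G]

/-- The underlying type of the twist of an extension by a cocycle. -/
structure Twist (E : Type*) where
  /-- The underlying element of `E`. -/
  val : E

/-- The twist of the group `E` by the inverse of a normalized 2-cocycle of `G`; it is an extension
whose Euler class is the difference of the two classes. -/
@[reducible]
def twistGroup (X : GroupExtension Z E G) (hX : IsCentral X) (ω : G → G → Z)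
    (hω : ∀ g h j, ω (g * h) j * ω g h = ω h j * ω g (h * j)) (hω₁ : ∀ g, ω 1 g = 1) :
    Group (Twist E) :=
  letI : Mul (Twist E) :=
    ⟨fun e f => ⟨X.inl (ω (X.rightHom e.val) (X.rightHom f.val))⁻¹ * (e.val * f.val)⟩⟩
  letI : One (Twist E) := ⟨⟨1⟩⟩
  letI : Inv (Twist E) :=
    ⟨fun e => ⟨X.inl (ω (X.rightHom e.val)⁻¹ (X.rightHom e.val)) * e.val⁻¹⟩⟩
  Group.ofLeftAxioms
    (fun ⟨a⟩ ⟨b⟩ ⟨c⟩ => by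
      refine congrArg Twist.mk ?_
      change X.inl (ω (X.rightHom (X.inl (ω (X.rightHom a) (X.rightHom b))⁻¹ * (a * b)))
          (X.rightHom c))⁻¹ * (X.inl (ω (X.rightHom a) (X.rightHom b))⁻¹ * (a * b) * c) =
        X.inl (ω (X.rightHom a) (X.rightHom
          (X.inl (ω (X.rightHom b) (X.rightHom c))⁻¹ * (b * c))))⁻¹ *
          (a * (X.inl (ω (X.rightHom b) (X.rightHom c))⁻¹ * (b * c)))
      -- Centrality collects the values of `ω` on the left; associativity is then the cocycle
      -- identity.
      rw [← mul_assoc a, inl_comm X hX _ a]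
      simp only [map_mul X.rightHom, X.rightHom_inl, one_mul, mul_assoc]
      rw [← mul_assoc, ← mul_assoc (X.inl _) (X.inl _), ← map_mul X.inl, ← map_mul X.inl, ← mul_inv,
        ← mul_inv, hω, mul_comm])
    (fun ⟨a⟩ => congrArg Twist.mk (by
      change X.inl (ω (X.rightHom 1) (X.rightHom a))⁻¹ * (1 * a) = a
      simp [hω₁]))
    (fun ⟨a⟩ => congrArg Twist.mk (by
      change X.inl (ω (X.rightHom (X.inl (ω (X.rightHom a)⁻¹ (X.rightHom a)) * a⁻¹))
        (X.rightHom a))⁻¹ * (X.inl (ω (X.rightHom a)⁻¹ (X.rightHom a)) * a⁻¹ * a) = 1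
      simp))

end Twist

section Coprod

open Monoid (Coprod)

instance group_fg_coprod {G₁ G₂ : Type*} [Group G₁] [Group G₂] [Group.FG G₁] [Group.FG G₂] :
    Group.FG (Coprod G₁ G₂) := by
  have h₁ := (Group.fg_iff_subgroup_fg _).1
    (inferInstance : Group.FG (Coprod.inl : G₁ →* Coprod G₁ G₂).range)
  have h₂ := (Group.fg_iff_subgroup_fg _).1
    (inferInstance : Group.FG (Coprod.inr : G₂ →* Coprod G₁ G₂).range)
  have h := h₁.sup h₂
  rw [Subgroup.sup_eq_closure, MonoidHom.coe_range, MonoidHom.coe_range,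
    Coprod.closure_range_inl_union_inr] at h
  exact Group.fg_def.2 h

/-- A central extension of a free product has bounded Euler class if its restrictions to the
factors do. -/
theorem isBoundedClass_coprod {Z : Type u} {E : Type w} {G₁ G₂ : Type u} [CommGroup Z] [Group E]
    [Group G₁] [Group G₂] (X : GroupExtension Z E (Coprod G₁ G₂)) (hX : IsCentral X)
    (h₁ : IsBoundedClass (eulerClass _
      (isCentral_restrict hX Coprod.inl Coprod.fst Coprod.fst_apply_inl)))
    (h₂ : IsBoundedClass (eulerClass _
      (isCentral_restrict hX Coprod.inr Coprod.snd Coprod.snd_apply_inr))) :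
    IsBoundedClass (eulerClass X hX) := by
  obtain ⟨s₁, hs₁, hf₁⟩ := exists_section_map_one _ h₁
  obtain ⟨s₂, hs₂, hf₂⟩ := exists_section_map_one _ h₂
  set c₁ := sectionCochain _ s₁
  set c₂ := sectionCochain _ s₂
  have hone₁ : ∀ g, c₁ (1, g) = 1 := fun g => sectionCochain_eq (by simp [hs₁])
  have hone₂ : ∀ g, c₂ (1, g) = 1 := fun g => sectionCochain_eq (by simp [hs₂])
  -- Each retraction kills the other factor and `c₁`, `c₂` are normalized, so `ω` restricts to `c₁`
  -- on `G₁` and to `c₂` on `G₂`.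
  let ω : Coprod G₁ G₂ → Coprod G₁ G₂ → Z := fun g h =>
    c₁ (Coprod.fst g, Coprod.fst h) * c₂ (Coprod.snd g, Coprod.snd h)
  have hω : ∀ g h j, ω (g * h) j * ω g h = ω h j * ω g (h * j) := fun g h j => by
    simp only [ω, map_mul]
    rw [mul_mul_mul_comm, sectionCochain_cocycle (isCentral_restrict hX _ _ _) s₁,
      sectionCochain_cocycle (isCentral_restrict hX _ _ _) s₂, mul_mul_mul_comm]
  let := twistGroup X hX ω hω fun g => by simp [ω, hone₁, hone₂]
  have hmul : ∀ a b : Twist E, (a * b).val =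
      X.inl (ω (X.rightHom a.val) (X.rightHom b.val))⁻¹ * (a.val * b.val) := fun _ _ => rfl
  let φ₁ : G₁ →* Twist E := MonoidHom.mk' (fun g => ⟨(s₁ g).1⟩) fun g h => by
    have h1 : X.inl (c₁ (g, h)) * (s₁ (g * h)).1 = (s₁ g).1 * (s₁ h).1 :=
      congrArg Subtype.val (inl_sectionCochain_mul _ s₁ g h)
    refine congrArg Twist.mk ?_
    change _ = X.inl (ω (X.rightHom (s₁ g).1) (X.rightHom (s₁ h).1))⁻¹ * ((s₁ g).1 * (s₁ h).1)
    rw [← h1, rightHom_restrict_section, rightHom_restrict_section]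
    simp [ω, hone₂]
  let φ₂ : G₂ →* Twist E := MonoidHom.mk' (fun g => ⟨(s₂ g).1⟩) fun g h => by
    have h1 : X.inl (c₂ (g, h)) * (s₂ (g * h)).1 = (s₂ g).1 * (s₂ h).1 :=
      congrArg Subtype.val (inl_sectionCochain_mul _ s₂ g h)
    refine congrArg Twist.mk ?_
    change _ = X.inl (ω (X.rightHom (s₂ g).1) (X.rightHom (s₂ h).1))⁻¹ * ((s₂ g).1 * (s₂ h).1)
    rw [← h1, rightHom_restrict_section, rightHom_restrict_section]
    simp [ω, hone₁]
  let π : Twist E →* Coprod G₁ G₂ :=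
    MonoidHom.mk' (fun e => X.rightHom e.val) fun a b => by simp [hmul]
  let φ : Coprod G₁ G₂ →* Twist E := Coprod.lift φ₁ φ₂
  have hπ : π.comp φ = MonoidHom.id _ :=
    Coprod.hom_ext (MonoidHom.ext fun g => rightHom_restrict_section s₁ g)
      (MonoidHom.ext fun g => rightHom_restrict_section s₂ g)
  have hφ : ∀ g, X.rightHom (φ g).val = g := DFunLike.congr_fun hπ
  refine (isBoundedClass_eulerClass_iff hX).2 ⟨⟨fun g => (φ g).val, hφ⟩, (hf₁.mul hf₂).subset ?_⟩
  rintro _ ⟨⟨g, h⟩, rfl⟩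
  refine ⟨_, ⟨(Coprod.fst g, Coprod.fst h), rfl⟩, _, ⟨(Coprod.snd g, Coprod.snd h), rfl⟩, ?_⟩
  -- Since `φ` is multiplicative for the twisted product, its failure to be so in `E` is exactly
  -- `ω`.
  refine (sectionCochain_eq (z := ω g h) ?_).symm
  change X.inl (ω g h) * (φ (g * h)).val = (φ g).val * (φ h).val
  rw [map_mul φ, hmul, hφ, hφ, map_inv, mul_inv_cancel_left]

end Coprod

end QITB

theorem corollary6 (G₁ G₂ : Type u) [Group G₁] [Group G₂]
    (h₁ : QITB.PropertyQITB.{u, w} G₁) (h₂ : QITB.PropertyQITB.{u, w} G₂) :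
    QITB.PropertyQITB.{u, w} (Monoid.Coprod G₁ G₂) := by
  obtain ⟨hG₁, h₁⟩ := h₁
  obtain ⟨hG₂, h₂⟩ := h₂
  refine ⟨inferInstance, fun Z E _ _ hZ X hX hq => ?_⟩
  exact QITB.isBoundedClass_coprod X hX
    (h₁ Z _ hZ _ _ (hq.restrict hX _ _ _)) (h₂ Z _ hZ _ _ (hq.restrict hX _ _ _))
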